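/- For an integer $N\ge 0$ identify a point $a=(a_1,\dots,a_N)\in\mathbf{R}^N$ with the monic polynomial $P(X)=X^N+a_1X^{N-1}+\cdots+a_N$ (put $a_0=1$), and let $\Omega_N\subset\mathbf{R}^N$ be the set of those $a$ for which all complex roots of $P$ have absolute value at most $1$. Let $dV$ be Lebesgue measure on $\mathbf{R}^N$ (for $N=0$, unit mass at the single point). Put $$D_{2m}=\prod_{k=0}^{m-1}\left(\frac{k!^2\,2^{2k+1}}{(2k+1)!}\right)^2,\qquad D_{2m+1}=\frac{m!^2\,2^{2m+1}}{(2m+1)!}\prod_{k=0}^{m-1}\left(\frac{k!^2\,2^{2k+1}}{(2k+1)!}\right)^2 .$$ For $\alpha,T\in\mathbf{C}$ with $\operatorname{Re}\alpha>0$ let $$C_N(\alpha,T)=\int_{\Omega_N}|a_N|^{\alpha-1}P(T)\,dV .$$ This integral converges absolutely, and the following hold for all $m\ge 0$ and all such $\alpha,T$. If $N=2m+1$, then $$C_N(\alpha,T)=D_N\left(\prod_{k=0}^{m}\frac{1+2k}{\alpha+2k}\right)\sum_{i=0}^{m}\frac{2i+1}{2m+1}\,\frac{m!^2}{(2m)!}\binom{2i}{i}\binom{2m-2i}{m-i}T^{2i+1}.$$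 If $N=2m$, then $$C_N(\alpha,T)=D_N\left(\prod_{k=0}^{m-1}\frac{1+2k}{\alpha+2k}\right)\sum_{i=0}^{m}\frac{2i+\alpha}{2m+\alpha}\,\frac{m!^2}{(2m)!}\binom{2i}{i}\binom{2m-2i}{m-i}T^{2i}.$$ Consequently, for every $N\ge 0$, with $r=\lfloor (N+1)/2\rfloor$ and $(x)_r=x(x+1)\cdots(x+r-1)$, the following integral converges absolutely and $$\int_{\Omega_N}|a_N|^{\alpha-1}\,dV=D_N\prod_{k=0}^{r-1}\frac{1+2k}{\alpha+2k}=D_N\,\frac{(1/2)_r}{(\alpha/2)_r},$$ and $\mathrm{Vol}(\Omega_N)=D_N$. -/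

import Mathlib

open MeasureTheory

namespace UnitDiscPoly

noncomputable section

/-- The full coefficient vector `(a₀, a₁, …, a_N)` with `a₀ = 1` attached to the point
`a = (a₁, …, a_N)` of `ℝ^N`. -/
def coeffs {N : ℕ} (a : Fin N → ℝ) : Fin (N + 1) → ℝ :=
  Fin.cons 1 a

/-- The last coefficient `a_N`. -/
def lastCoeff {N : ℕ} (a : Fin N → ℝ) : ℝ :=
  coeffs a (Fin.last N)

/-- The monic polynomial `P = X^N + a₁ X^(N-1) + ⋯ + a_N`. -/
def poly {N : ℕ} (a : Fin N → ℝ) : Polynomial ℝ :=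
  ∑ i : Fin (N + 1), Polynomial.C (coeffs a i) * Polynomial.X ^ (N - (i : ℕ))

/-- The region of `ℝ^N` parametrizing the monic real polynomials of degree `N` all of whose
complex roots have absolute value at most `1`. -/
def Omega (N : ℕ) : Set (Fin N → ℝ) :=
  {a | ∀ z : ℂ, Polynomial.aeval z (poly a) = 0 → ‖z‖ ≤ 1}

/-- The integrand `|a_N|^(α-1) P(T)`. -/
def integrand (N : ℕ) (α T : ℂ) (a : Fin N → ℝ) : ℂ :=
  ((|lastCoeff a| : ℝ) : ℂ) ^ (α - 1) * Polynomial.aeval T (poly a)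

/-- The integral `C_N(α, T)`, with respect to Lebesgue measure on `ℝ^N`. -/
def C (N : ℕ) (α T : ℂ) : ℂ :=
  ∫ a in Omega N, integrand N α T a

/-- The factor `k!² 2^(2k+1) / (2k+1)!`. -/
def factor (k : ℕ) : ℝ :=
  ((k.factorial : ℝ) ^ 2 * 2 ^ (2 * k + 1)) / ((2 * k + 1).factorial : ℝ)

/-- The constant `D_N`; here `N / 2` is the `m` with `N = 2m` or `N = 2m + 1`. -/
def D (N : ℕ) : ℝ :=
  if Even N then ∏ k ∈ Finset.range (N / 2), factor k ^ 2
  else factor (N / 2) * ∏ k ∈ Finset.range (N / 2), factor k ^ 2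

end

end UnitDiscPoly

namespace UnitDiscPoly

noncomputable section

/-! The proof peels off the last coefficient by the Levinson (Schur–Cohn) recursion. For |k| < 1
every monic Q of degree n+1 with last coefficient k is uniquely X P + k P*, where P* reverses the
coefficients of P, and Q lies in `Omega (n+1)` exactly when P lies in `Omega n`
(`levinson_mem_Omega_iff`). For fixed k the map from P to the other coefficients of Q is linear,
with determinant (1-k²)^m for n = 2m and (1-k²)^m (1+k) for n = 2m+1. Hence
`setIntegral_Omega_succ`: an integral over `Omega (n+1)` is an integral over k in (-1,1) of
integrals over `Omega n`.

The weight |a_N|^(α-1) becomes |k|^(α-1) and leaves the inner integral, so the moments of the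
coefficients in degree n+1 with parameter α are beta integrals times moments in degree n with
parameter 1 (`moment_odd`, `moment_even`). Induction on the degree gives every moment in closed
form; those of odd index vanish. Summing them against powers of T gives C_N; index 0 gives the
moments of |a_N|, and α = 1 the volume. -/

/-- The coefficient `a_j`, extended by zero to all indices `j`. -/
def coeffAt {N : ℕ} (a : Fin N → ℝ) (j : ℕ) : ℝ :=
  if h : j < N + 1 then coeffs a ⟨j, h⟩ else 0

/-- The reversed polynomial `1 + a₁ z + ⋯ + a_N z^N`. -/
def revEval {N : ℕ} (z : ℂ) (a : Fin N → ℝ) : ℂ :=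
  ∑ j ∈ Finset.range (N + 1), (coeffAt a j : ℂ) * z ^ j

/-- The linear map `b ↦ b + k • (b ∘ rev)`. -/
def reflectMap (n : ℕ) (k : ℝ) : (Fin n → ℝ) →ₗ[ℝ] (Fin n → ℝ) :=
  LinearMap.id + k • LinearMap.funLeft ℝ ℝ Fin.rev

/-- The coefficients of `X P + k P*`, where `P*` is the reversed polynomial of `P`. -/
def levinson {n : ℕ} (k : ℝ) (b : Fin n → ℝ) : Fin (n + 1) → ℝ :=
  Fin.snoc (α := fun _ => ℝ) (reflectMap n k b) k

/-! ### Coefficients and values of X P + k P*. -/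

lemma reflectMap_apply (n : ℕ) (k : ℝ) (b : Fin n → ℝ) (i : Fin n) :
    reflectMap n k b i = b i + k * b i.rev := by
  simp [reflectMap, LinearMap.funLeft_apply]

lemma coeffAt_zero {N : ℕ} (a : Fin N → ℝ) : coeffAt a 0 = 1 := by
  simp [coeffAt, coeffs]

lemma coeffAt_succ {N : ℕ} (a : Fin N → ℝ) {j : ℕ} (h : j < N) :
    coeffAt a (j + 1) = a ⟨j, h⟩ := by
  have : (⟨j + 1, by omega⟩ : Fin (N + 1)) = Fin.succ ⟨j, h⟩ := rfl
  rw [coeffAt, dif_pos (by omega), coeffs, this, Fin.cons_succ]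

lemma coeffAt_of_lt {N : ℕ} (a : Fin N → ℝ) {j : ℕ} (h : N < j) : coeffAt a j = 0 := by
  rw [coeffAt, dif_neg (by omega)]

lemma lastCoeff_eq {n : ℕ} (a : Fin (n + 1) → ℝ) : lastCoeff a = a (Fin.last n) := by
  rw [lastCoeff, coeffs, ← Fin.succ_last, Fin.cons_succ]

lemma lastCoeff_zero (a : Fin 0 → ℝ) : lastCoeff a = 1 := by
  simp [lastCoeff, coeffs]

lemma lastCoeff_levinson {n : ℕ} (k : ℝ) (b : Fin n → ℝ) : lastCoeff (levinson k b) = k := by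
  simp [lastCoeff_eq, levinson]

/-- Extension by zero lets one formula cover both ends: at j = 0 and at j = n+1 one of the two terms
is `coeffAt b (n + 1) = 0`. -/
lemma coeffAt_levinson {n : ℕ} (k : ℝ) (b : Fin n → ℝ) {j : ℕ} (hj : j ≤ n + 1) :
    coeffAt (levinson k b) j = coeffAt b j + k * coeffAt b (n + 1 - j) := by
  rcases j with _ | j
  · simp [coeffAt_zero, coeffAt_of_lt]
  rw [coeffAt_succ _ (by omega)]
  rcases lt_or_eq_of_le (show j ≤ n by omega) with h | rfl
  · rw [coeffAt_succ _ h, show n + 1 - (j + 1) = (n - 1 - j) + 1 by omega,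
      coeffAt_succ _ (by omega), levinson,
      show (⟨j, by omega⟩ : Fin (n + 1)) = Fin.castSucc ⟨j, h⟩ from rfl, Fin.snoc_castSucc,
      reflectMap_apply]
    congr 3
    ext
    simp only [Fin.val_rev]
    omega
  · rw [coeffAt_of_lt b (Nat.lt_succ_self _), levinson,
      show (⟨j, by omega⟩ : Fin (j + 1)) = Fin.last j from rfl, Fin.snoc_last]
    simp [coeffAt_zero]

lemma aeval_poly {N : ℕ} (a : Fin N → ℝ) (z : ℂ) :
    Polynomial.aeval z (poly a) =
      ∑ j ∈ Finset.range (N + 1), (coeffAt a j : ℂ) * z ^ (N - j) := by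
  rw [Finset.sum_range, poly, map_sum]
  refine Finset.sum_congr rfl fun i _ => ?_
  rw [coeffAt, dif_pos i.2]
  simp

lemma aeval_poly_levinson {n : ℕ} (k : ℝ) (b : Fin n → ℝ) (z : ℂ) :
    Polynomial.aeval z (poly (levinson k b)) =
      z * Polynomial.aeval z (poly b) + k * revEval z b := by
  have h1 : ∀ j ∈ Finset.range (n + 1 + 1),
      (coeffAt (levinson k b) j : ℂ) * z ^ (n + 1 - j) =
        (coeffAt b j : ℂ) * z ^ (n + 1 - j) +
          k * ((coeffAt b (n + 1 - j) : ℂ) * z ^ (n + 1 - j)) := by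
    intro j hj
    rw [coeffAt_levinson k b (by simpa [Nat.lt_succ_iff] using hj)]
    push_cast
    ring
  have h2 := Finset.sum_range_reflect (fun j => (coeffAt b j : ℂ) * z ^ j) (n + 1 + 1)
  simp only [Nat.add_sub_cancel] at h2
  rw [aeval_poly, Finset.sum_congr rfl h1, Finset.sum_add_distrib, ← Finset.mul_sum, h2,
    Finset.sum_range_succ, Finset.sum_range_succ _ (n + 1), coeffAt_of_lt b (Nat.lt_succ_self n),
    aeval_poly, revEval, Finset.mul_sum]
  simp only [Complex.ofReal_zero, zero_mul, add_zero]
  congr 1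
  refine Finset.sum_congr rfl fun j hj => ?_
  rw [Finset.mem_range] at hj
  rw [show n + 1 - j = (n - j) + 1 by omega, pow_succ]
  ring

lemma revEval_levinson {n : ℕ} (k : ℝ) (b : Fin n → ℝ) (z : ℂ) :
    revEval z (levinson k b) =
      revEval z b + k * (z * Polynomial.aeval z (poly b)) := by
  have h1 : ∀ j ∈ Finset.range (n + 1 + 1),
      (coeffAt (levinson k b) j : ℂ) * z ^ j =
        (coeffAt b j : ℂ) * z ^ j +
          k * ((coeffAt b (n + 1 - j) : ℂ) * z ^ (n + 1 - (n + 1 - j))) := by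
    intro j hj
    rw [Finset.mem_range] at hj
    rw [coeffAt_levinson k b (by omega), show n + 1 - (n + 1 - j) = j by omega]
    push_cast
    ring
  have h2 := Finset.sum_range_reflect (fun j => (coeffAt b j : ℂ) * z ^ (n + 1 - j)) (n + 1 + 1)
  simp only [Nat.add_sub_cancel] at h2
  rw [revEval, Finset.sum_congr rfl h1, Finset.sum_add_distrib, ← Finset.mul_sum, h2,
    Finset.sum_range_succ, Finset.sum_range_succ _ (n + 1), coeffAt_of_lt b (Nat.lt_succ_self n),
    aeval_poly, revEval, Finset.mul_sum (a := z)]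
  simp only [Complex.ofReal_zero, zero_mul, add_zero]
  congr 2
  refine Finset.sum_congr rfl fun j hj => ?_
  rw [Finset.mem_range] at hj
  rw [show n + 1 - j = (n - j) + 1 by omega, pow_succ]
  ring

lemma revEval_eq {N : ℕ} (a : Fin N → ℝ) {z : ℂ} (hz : z ≠ 0) :
    revEval z a = z ^ N * Polynomial.aeval z⁻¹ (poly a) := by
  rw [revEval, aeval_poly, Finset.mul_sum]
  refine Finset.sum_congr rfl fun j hj => ?_
  rw [Finset.mem_range] at hj
  have : z ^ N = z ^ j * z ^ (N - j) := by rw [← pow_add]; congr 1; omega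
  rw [this, inv_pow]
  field_simp

/-! ### Roots, and bounds outside the unit disc. -/

lemma poly_eq {N : ℕ} (a : Fin N → ℝ) :
    poly a = Polynomial.X ^ N +
      ∑ i : Fin N, Polynomial.C (a i) * Polynomial.X ^ (N - ((i : ℕ) + 1)) := by
  rw [poly, Fin.sum_univ_succ]
  simp [coeffs]

lemma degree_tail_lt {N : ℕ} (a : Fin N → ℝ) :
    (∑ i : Fin N, Polynomial.C (a i) * Polynomial.X ^ (N - ((i : ℕ) + 1))).degree <
      (N : WithBot ℕ) := by
  refine (Polynomial.degree_sum_le _ _).trans_lt ?_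
  refine (Finset.sup_lt_iff (WithBot.bot_lt_coe N)).2 fun i _ => ?_
  refine (Polynomial.degree_C_mul_X_pow_le _ _).trans_lt ?_
  have := i.2
  exact WithBot.coe_lt_coe.2 (by omega : N - ((i : ℕ) + 1) < N)

lemma monic_poly {N : ℕ} (a : Fin N → ℝ) : (poly a).Monic := by
  rw [poly_eq]
  exact Polynomial.monic_X_pow_add (degree_tail_lt a)

lemma natDegree_poly {N : ℕ} (a : Fin N → ℝ) : (poly a).natDegree = N := by
  apply Polynomial.natDegree_eq_of_degree_eq_some
  rw [poly_eq, Polynomial.degree_add_eq_left_of_degree_lt] <;> rw [Polynomial.degree_X_pow]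
  exact degree_tail_lt a

lemma coeff_poly {N : ℕ} (a : Fin N → ℝ) {j : ℕ} (hj : j ≤ N) :
    (poly a).coeff (N - j) = coeffAt a j := by
  rw [poly, Polynomial.finsetSum_coeff, Finset.sum_eq_single ⟨j, by omega⟩]
  · simp [coeffAt, Nat.lt_succ_of_le hj]
  · intro i _ hi
    have h1 : (i : ℕ) ≠ j := fun h => hi (Fin.ext h)
    have := i.2
    rw [Polynomial.coeff_C_mul_X_pow, if_neg (by omega)]
  · simp

/-- The complex roots of the polynomial attached to `a`. -/
def rootSet {N : ℕ} (a : Fin N → ℝ) : Multiset ℂ :=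
  ((poly a).map (algebraMap ℝ ℂ)).roots

lemma aeval_poly_eq_prod {N : ℕ} (a : Fin N → ℝ) (z : ℂ) :
    Polynomial.aeval z (poly a) = ((rootSet a).map fun r => z - r).prod := by
  rw [rootSet, ← (IsAlgClosed.splits _).eval_eq_prod_roots_of_monic ((monic_poly a).map _),
    Polynomial.eval_map_algebraMap]

lemma card_rootSet {N : ℕ} (a : Fin N → ℝ) : Multiset.card (rootSet a) = N := by
  rw [rootSet, ← (IsAlgClosed.splits _).natDegree_eq_card_roots,
    (monic_poly a).natDegree_map, natDegree_poly]

lemma norm_le_one_of_mem_rootSet {N : ℕ} {a : Fin N → ℝ} (ha : a ∈ Omega N) {r : ℂ}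
    (hr : r ∈ rootSet a) : ‖r‖ ≤ 1 := by
  apply ha
  have := (Polynomial.mem_roots'.1 hr).2
  rwa [Polynomial.IsRoot, Polynomial.eval_map_algebraMap] at this

lemma multiset_norm_prod_le {s : Multiset ℂ} {f g : ℂ → ℂ} (h : ∀ r ∈ s, ‖f r‖ ≤ ‖g r‖) :
    ‖(s.map f).prod‖ ≤ ‖(s.map g).prod‖ := by
  induction s using Multiset.induction_on with
  | empty => simp
  | cons r s ih =>
    simp only [Multiset.map_cons, Multiset.prod_cons, norm_mul]
    exact mul_le_mul (h r (by simp)) (ih fun x hx => h x (by simp [hx])) (norm_nonneg _)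
      (norm_nonneg _)

lemma pow_le_norm_aeval {N : ℕ} {a : Fin N → ℝ} (ha : a ∈ Omega N) {z : ℂ} (hz : 1 < ‖z‖) :
    (‖z‖ - 1) ^ N ≤ ‖Polynomial.aeval z (poly a)‖ := by
  have h := multiset_norm_prod_le (s := rootSet a) (f := fun _ => ((‖z‖ - 1 : ℝ) : ℂ))
    (g := fun r => z - r) (fun r hr => by
      have h1 := norm_le_one_of_mem_rootSet ha hr
      have h2 := norm_sub_norm_le z r
      rw [Complex.norm_real, Real.norm_eq_abs, abs_of_pos (by linarith)]
      linarith)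
  rw [← aeval_poly_eq_prod, Multiset.map_const', Multiset.prod_replicate, card_rootSet, norm_pow,
    Complex.norm_real, Real.norm_eq_abs, abs_of_pos (by linarith)] at h
  exact h

/-- Describes the region by non-strict inequalities continuous in a, from which closedness is
immediate. -/
lemma Omega_eq (N : ℕ) :
    Omega N = {a | ∀ z : ℂ, 1 < ‖z‖ → (‖z‖ - 1) ^ N ≤ ‖Polynomial.aeval z (poly a)‖} := by
  ext a
  refine ⟨fun ha z hz => pow_le_norm_aeval ha hz, fun ha z hz => ?_⟩
  by_contra! h
  have h1 := ha z h
  rw [hz, norm_zero] at h1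
  have : 0 < (‖z‖ - 1) ^ N := pow_pos (by linarith) _
  linarith

/-- The difference of the squared norms is (|z|² - 1)(1 - |r|²). -/
lemma norm_one_sub_le {r z : ℂ} (hr : ‖r‖ ≤ 1) (hz : 1 ≤ ‖z‖) :
    ‖1 - starRingEnd ℂ r * z‖ ≤ ‖z - r‖ := by
  rw [← sq_le_sq₀ (norm_nonneg _) (norm_nonneg _), ← Complex.normSq_eq_norm_sq,
    ← Complex.normSq_eq_norm_sq]
  have h1 : Complex.normSq r ≤ 1 := by
    rw [Complex.normSq_eq_norm_sq]; exact pow_le_one₀ (norm_nonneg _) hr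
  have h2 : 1 ≤ Complex.normSq z := by
    rw [Complex.normSq_eq_norm_sq]; exact one_le_pow₀ hz
  simp only [Complex.normSq_apply, Complex.sub_re, Complex.sub_im, Complex.mul_re, Complex.mul_im,
    Complex.conj_re, Complex.conj_im, Complex.one_re, Complex.one_im] at *
  nlinarith [mul_nonneg (sub_nonneg.2 h1) (sub_nonneg.2 h2)]

lemma norm_revEval_le {N : ℕ} {a : Fin N → ℝ} (ha : a ∈ Omega N) {z : ℂ} (hz : 1 < ‖z‖) :
    ‖revEval z a‖ ≤ ‖Polynomial.aeval z (poly a)‖ := by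
  have hz0 : z ≠ 0 := by
    rintro rfl
    simp at hz
    linarith
  have hz1 : starRingEnd ℂ z ≠ 0 := by simpa using hz0
  -- Real coefficients allow evaluation at the conjugate of 1/z, so that each factor of P*(z)
  -- becomes, up to conjugation, 1 - r̄z, to be compared with the factor z - r of P(z).
  have hconj : Polynomial.aeval z⁻¹ (poly a) =
      starRingEnd ℂ (Polynomial.aeval (starRingEnd ℂ z)⁻¹ (poly a)) := by
    simp [aeval_poly, map_sum]
  have h := multiset_norm_prod_le (s := rootSet a)
    (f := fun r => starRingEnd ℂ z * ((starRingEnd ℂ z)⁻¹ - r))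
    (g := fun r => z - r) (fun r hr => by
      have h1 : starRingEnd ℂ z * ((starRingEnd ℂ z)⁻¹ - r) =
          starRingEnd ℂ (1 - starRingEnd ℂ r * z) := by
        rw [mul_sub, mul_inv_cancel₀ hz1]
        simp [mul_comm]
      simp only [h1, Complex.norm_conj]
      exact norm_one_sub_le (norm_le_one_of_mem_rootSet ha hr) hz.le)
  rw [Multiset.prod_map_mul, Multiset.map_const', Multiset.prod_replicate, card_rootSet,
    ← aeval_poly_eq_prod, ← aeval_poly_eq_prod] at h
  rw [revEval_eq a hz0, hconj]
  simpa using h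

/-! ### Stability of the region under the recursion; compactness. -/

lemma mem_Omega_iff {N : ℕ} {a : Fin N → ℝ} :
    a ∈ Omega N ↔ ∀ z : ℂ, 1 < ‖z‖ → Polynomial.aeval z (poly a) ≠ 0 := by
  refine forall_congr' fun z => ?_
  rw [← not_lt, imp_not_comm]

/-- Both directions use |P*| ≤ |P| outside the disc. If P has no zero there, then |zP| > |kP*|, so Q
= X P + k P* has none. Conversely, at a zero z of P one has Q = kP* and Q* = P*, and |Q*| ≤ |Q| ≠ 0
contradicts |k| < 1. -/
lemma levinson_mem_Omega_iff {n : ℕ} {k : ℝ} (hk : |k| < 1) (b : Fin n → ℝ) :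
    levinson k b ∈ Omega (n + 1) ↔ b ∈ Omega n := by
  have hk' : ‖(k : ℂ)‖ < 1 := by simpa using hk
  constructor
  · intro h
    rw [mem_Omega_iff]
    intro z hz h0
    have h1 := norm_revEval_le h hz
    have h2 := mem_Omega_iff.1 h z hz
    rw [revEval_levinson, aeval_poly_levinson, h0] at h1
    rw [aeval_poly_levinson, h0] at h2
    simp only [mul_zero, add_zero, zero_add, norm_mul] at h1 h2
    have : 0 < ‖revEval z b‖ := norm_pos_iff.2 (right_ne_zero_of_mul h2)
    nlinarith
  · intro h
    rw [mem_Omega_iff]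
    intro z hz h0
    rw [aeval_poly_levinson] at h0
    have h1 := norm_revEval_le h hz
    have h2 : 0 < ‖Polynomial.aeval z (poly b)‖ := norm_pos_iff.2 (mem_Omega_iff.1 h z hz)
    have h3 := congrArg norm (eq_neg_of_add_eq_zero_left h0)
    rw [norm_neg, norm_mul, norm_mul] at h3
    have h4 : ‖(k : ℂ)‖ * ‖revEval z b‖ ≤ 1 * ‖Polynomial.aeval z (poly b)‖ :=
      mul_le_mul hk'.le h1 (norm_nonneg _) zero_le_one
    nlinarith

lemma abs_coeffAt_le {N : ℕ} {a : Fin N → ℝ} (ha : a ∈ Omega N) {j : ℕ} (hj : j ≤ N) :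
    |coeffAt a j| ≤ N.choose j := by
  have h := Polynomial.coeff_le_of_roots_le (p := poly a) (f := algebraMap ℝ ℂ) (B := 1) (N - j)
    (monic_poly a) (IsAlgClosed.splits _) (fun z hz => norm_le_one_of_mem_rootSet ha hz)
  rw [Polynomial.coeff_map, coeff_poly a hj, natDegree_poly, one_pow, one_mul,
    Nat.choose_symm hj] at h
  simpa using h

lemma abs_lastCoeff_le {N : ℕ} {a : Fin N → ℝ} (ha : a ∈ Omega N) : |lastCoeff a| ≤ 1 := by
  have h := abs_coeffAt_le ha le_rfl
  rw [coeffAt, dif_pos (Nat.lt_succ_self N), Nat.choose_self, Nat.cast_one] at h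
  exact h

lemma continuous_coeffAt {N : ℕ} (j : ℕ) : Continuous fun a : Fin N → ℝ => coeffAt a j := by
  rcases j with _ | j
  · simp only [coeffAt_zero]; exact continuous_const
  · by_cases h : j < N
    · simp only [coeffAt_succ _ h]; exact continuous_apply _
    · simp only [coeffAt_of_lt _ (show N < j + 1 by omega)]; exact continuous_const

lemma continuous_aeval_poly {N : ℕ} (z : ℂ) :
    Continuous fun a : Fin N → ℝ => Polynomial.aeval z (poly a) := by
  simp only [aeval_poly]
  exact continuous_finsetSum _ fun j _ =>
    (Complex.continuous_ofReal.comp (continuous_coeffAt j)).mul continuous_const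

lemma isClosed_Omega (N : ℕ) : IsClosed (Omega N) := by
  rw [Omega_eq]
  simp only [Set.ofPred_forall]
  exact isClosed_iInter fun z => isClosed_iInter fun _ =>
    isClosed_le continuous_const (continuous_aeval_poly z).norm

lemma isCompact_Omega (N : ℕ) : IsCompact (Omega N) := by
  refine Metric.isCompact_of_isClosed_isBounded (isClosed_Omega N) ?_
  refine (Metric.isBounded_closedBall (x := (0 : Fin N → ℝ)) (r := 2 ^ N)).subset fun a ha => ?_
  rw [mem_closedBall_zero_iff, pi_norm_le_iff_of_nonneg (by positivity)]
  intro i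
  have h := abs_coeffAt_le ha (show (i : ℕ) + 1 ≤ N from i.2)
  rw [coeffAt_succ a i.2] at h
  refine h.trans ?_
  exact_mod_cast Nat.choose_le_two_pow N _

/-! ### The Jacobian and the fibration over the last coefficient. -/

/-- Pairing each index with its mirror image splits the matrix into 2×2 blocks of determinant 1 -
k²; for p = m + 1 the fixed middle index adds 1 + k. The Schur complement of the first m indices is
the resulting diagonal matrix. -/
lemma det_reflectMap_add (k : ℝ) (m p : ℕ) (hp : p = m ∨ p = m + 1) :
    LinearMap.det (reflectMap (m + p) k) =
      ∏ i : Fin p, if (i : ℕ) < m then 1 - k ^ 2 else 1 + k := by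
  -- The second summand is reversed, so `inl i` and `inr i` are mirror images and all four blocks
  -- are diagonal.
  let e : Fin m ⊕ Fin p ≃ Fin (m + p) :=
    (Equiv.sumCongr (Equiv.refl _) Fin.revPerm).trans finSumFinEquiv
  have he1 : ∀ i : Fin m, (e (Sum.inl i) : ℕ) = i := fun i => by simp [e]
  have he2 : ∀ i : Fin p, (e (Sum.inr i) : ℕ) = m + (p - (i + 1)) := fun i => by
    simp [e]
  have hM : ∀ i j, LinearMap.toMatrix' (reflectMap (m + p) k) i j =
      (if (i : ℕ) = j then 1 else 0) + k * (if m + p - (i + 1) = (j : ℕ) then 1 else 0) := by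
    intro i j
    rw [LinearMap.toMatrix'_apply, reflectMap_apply]
    simp [Pi.single_apply, Fin.ext_iff]
  rw [← LinearMap.det_toMatrix', ← Matrix.det_submatrix_equiv_self e]
  have hblock : (LinearMap.toMatrix' (reflectMap (m + p) k)).submatrix e e =
      Matrix.fromBlocks (1 : Matrix (Fin m) (Fin m) ℝ)
        (Matrix.of fun (i : Fin m) (j : Fin p) => if (i : ℕ) = j then k else 0)
        (Matrix.of fun (i : Fin p) (j : Fin m) => if (i : ℕ) = j then k else 0)
        (Matrix.diagonal fun i : Fin p => if (i : ℕ) < m then 1 else 1 + k) := by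
    ext i j
    rcases i with i | i <;> rcases j with j | j <;>
      simp only [Matrix.submatrix_apply, hM, he1, he2, Matrix.fromBlocks_apply₁₁,
        Matrix.fromBlocks_apply₁₂, Matrix.fromBlocks_apply₂₁, Matrix.fromBlocks_apply₂₂,
        Matrix.one_apply, Matrix.of_apply, Matrix.diagonal_apply, Fin.ext_iff]
    all_goals
      have hi := i.2
      have hj := j.2
      split_ifs <;> first | omega | simp
  have hschur : (Matrix.diagonal fun i : Fin p => if (i : ℕ) < m then 1 else 1 + k) -
      (Matrix.of fun (i : Fin p) (j : Fin m) => if (i : ℕ) = j then k else 0) *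
        (Matrix.of fun (i : Fin m) (j : Fin p) => if (i : ℕ) = j then k else 0) =
      Matrix.diagonal fun i : Fin p => if (i : ℕ) < m then 1 - k ^ 2 else 1 + k := by
    ext i j
    rw [Matrix.sub_apply, Matrix.mul_apply]
    simp only [Matrix.of_apply, Matrix.diagonal_apply]
    by_cases him : (i : ℕ) < m
    · rw [Finset.sum_eq_single (⟨i, him⟩ : Fin m)]
      · simp only [if_true, him, Fin.ext_iff]
        split_ifs <;> ring
      · intro l _ hl
        rw [if_neg (fun h => hl (Fin.ext h.symm)), zero_mul]
      · simp
    · rw [Finset.sum_eq_zero]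
      · simp [him]
      · intro l _
        have := l.2
        rw [if_neg (by omega), zero_mul]
  rw [hblock, Matrix.det_fromBlocks_one₁₁, hschur, Matrix.det_diagonal]

lemma det_reflectMap_even (k : ℝ) (m : ℕ) :
    LinearMap.det (reflectMap (2 * m) k) = (1 - k ^ 2) ^ m := by
  rw [two_mul, det_reflectMap_add k m m (Or.inl rfl)]
  simp

lemma det_reflectMap_odd (k : ℝ) (m : ℕ) :
    LinearMap.det (reflectMap (2 * m + 1) k) = (1 - k ^ 2) ^ m * (1 + k) := by
  rw [two_mul, add_assoc, det_reflectMap_add k m (m + 1) (Or.inr rfl), Fin.prod_univ_castSucc]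
  simp

lemma det_reflectMap_pos {k : ℝ} (hk : |k| < 1) (n : ℕ) :
    0 < LinearMap.det (reflectMap n k) := by
  have h1 : 0 < 1 - k ^ 2 := by
    have := (sq_lt_one_iff_abs_lt_one k).2 hk
    linarith
  have h2 : 0 < 1 + k := by linarith [(abs_lt.1 hk).1]
  rcases Nat.even_or_odd' n with ⟨m, rfl | rfl⟩
  · rw [det_reflectMap_even]; positivity
  · rw [det_reflectMap_odd]; positivity

lemma bijective_reflectMap {k : ℝ} (hk : |k| < 1) (n : ℕ) :
    Function.Bijective (reflectMap n k) := by
  rw [← Module.End.isUnit_iff, LinearMap.isUnit_iff_isUnit_det]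
  exact (det_reflectMap_pos hk n).ne'.isUnit

lemma snoc_preimage_Omega {n : ℕ} {k : ℝ} (hk : |k| < 1) :
    {c : Fin n → ℝ | Fin.snoc (α := fun _ => ℝ) c k ∈ Omega (n + 1)} =
      reflectMap n k '' Omega n := by
  ext c
  obtain ⟨b, rfl⟩ := (bijective_reflectMap hk n).2 c
  rw [(bijective_reflectMap hk n).1.mem_set_image]
  exact levinson_mem_Omega_iff hk b

lemma setIntegral_image_reflectMap {n : ℕ} {k : ℝ} (hk : |k| < 1) (g : (Fin n → ℝ) → ℂ) :
    ∫ c in reflectMap n k '' Omega n, g c =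
      ((LinearMap.det (reflectMap n k) : ℝ) : ℂ) * ∫ b in Omega n, g (reflectMap n k b) := by
  let f : (Fin n → ℝ) →L[ℝ] (Fin n → ℝ) := LinearMap.toContinuousLinearMap (reflectMap n k)
  have h := integral_image_eq_integral_abs_det_fderiv_smul volume
    (isClosed_Omega n).measurableSet (f := f) (f' := fun _ => f)
    (fun x _ => f.hasFDerivAt.hasFDerivWithinAt) (bijective_reflectMap hk n).1.injOn g
  have hdet : |f.det| = LinearMap.det (reflectMap n k) :=
    abs_of_pos (det_reflectMap_pos hk n)
  rw [hdet, integral_smul, Complex.real_smul] at h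
  exact h

/-- The volume integral over the coefficient region fibred over the last coefficient. -/
theorem setIntegral_Omega_succ {n : ℕ} (G : (Fin (n + 1) → ℝ) → ℂ)
    (hG : IntegrableOn G (Omega (n + 1))) :
    ∫ a in Omega (n + 1), G a =
      ∫ k in Set.Ioo (-1 : ℝ) 1, ((LinearMap.det (reflectMap n k) : ℝ) : ℂ) *
        ∫ b in Omega n, G (levinson k b) := by
  have hmeas : MeasurableSet (Omega (n + 1)) := (isClosed_Omega _).measurableSet
  let e := MeasurableEquiv.piFinSuccAbove (fun _ : Fin (n + 1) => ℝ) (Fin.last n)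
  have he : MeasurePreserving e.symm :=
    (volume_preserving_piFinSuccAbove (fun _ : Fin (n + 1) => ℝ) (Fin.last n)).symm e
  have hes : ∀ k c, e.symm (k, c) = Fin.snoc (α := fun _ => ℝ) c k := by
    intro k c
    exact Fin.insertNth_last' k c
  have hint : Integrable (fun p => (Omega (n + 1)).indicator G (e.symm p))
      ((volume : Measure ℝ).prod volume) :=
    (he.integrable_comp_emb e.symm.measurableEmbedding).2 ((integrable_indicator_iff hmeas).2 hG)
  rw [← integral_indicator hmeas, ← he.integral_comp e.symm.measurableEmbedding,
    Measure.volume_eq_prod, integral_prod _ hint, ← integral_indicator measurableSet_Ioo]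
  -- The recursion needs |k| < 1; the values ±1 form a null set, and for |k| > 1 the fibre is empty.
  have hae : ∀ᵐ k : ℝ, k ≠ 1 ∧ k ≠ -1 :=
    (Measure.ae_ne volume 1).and (Measure.ae_ne volume (-1))
  refine integral_congr_ae (hae.mono fun k hk => ?_)
  simp only [hes]
  by_cases h : k ∈ Set.Ioo (-1 : ℝ) 1
  · rw [Set.indicator_of_mem h]
    have h' : |k| < 1 := abs_lt.2 h
    have := setIntegral_image_reflectMap h' fun c => G (Fin.snoc (α := fun _ => ℝ) c k)
    rw [← snoc_preimage_Omega h', ← integral_indicator] at this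
    · exact this
    · rw [snoc_preimage_Omega h']
      exact ((isCompact_Omega n).image
        (LinearMap.continuous_of_finiteDimensional _)).measurableSet
  · rw [Set.indicator_of_notMem h]
    have h0 : ∀ c : Fin n → ℝ, Fin.snoc (α := fun _ => ℝ) c k ∉ Omega (n + 1) := by
      intro c hc
      have h1 := abs_lastCoeff_le hc
      rw [lastCoeff_eq, Fin.snoc_last, abs_le] at h1
      exact h ⟨lt_of_le_of_ne h1.1 (Ne.symm hk.2), lt_of_le_of_ne h1.2 hk.1⟩
    simp [h0]

/-! ### One-dimensional beta integrals. -/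

lemma intervalIntegrable_abs_cpow {s : ℂ} (hs : -1 < s.re) :
    IntervalIntegrable (fun x : ℝ => ((|x| : ℝ) : ℂ) ^ s) volume (-1) 1 := by
  have h : IntervalIntegrable (fun x : ℝ => ((|x| : ℝ) : ℂ) ^ s) volume 0 1 := by
    refine (intervalIntegral.intervalIntegrable_cpow' hs (a := 0) (b := 1)).congr ?_
    intro x hx
    rw [Set.uIoc_of_le zero_le_one] at hx
    simp [abs_of_pos hx.1]
  have h' : IntervalIntegrable (fun x : ℝ => ((|x| : ℝ) : ℂ) ^ s) volume (-1) 0 := by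
    have := (h.comp_sub_left 0).symm
    simpa using this
  exact h'.trans h

lemma integral_abs_cpow {s : ℂ} (hs : -1 < s.re) :
    ∫ x in (-1 : ℝ)..1, ((|x| : ℝ) : ℂ) ^ s = 2 / (s + 1) := by
  have hi := intervalIntegrable_abs_cpow hs
  have h : ∫ x in (0 : ℝ)..1, ((|x| : ℝ) : ℂ) ^ s = 1 / (s + 1) := by
    have h1 : ∫ x in (0 : ℝ)..1, ((|x| : ℝ) : ℂ) ^ s = ∫ x in (0 : ℝ)..1, (x : ℂ) ^ s := by
      refine intervalIntegral.integral_congr fun x hx => ?_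
      rw [Set.uIcc_of_le zero_le_one] at hx
      simp [abs_of_nonneg hx.1]
    have hs1 : s + 1 ≠ 0 := by
      intro h0
      have := congrArg Complex.re h0
      simp at this
      linarith
    rw [h1, integral_cpow (Or.inl hs)]
    simp [Complex.zero_cpow hs1]
  have h' : ∫ x in (-1 : ℝ)..0, ((|x| : ℝ) : ℂ) ^ s = 1 / (s + 1) := by
    rw [← h]
    have := intervalIntegral.integral_comp_neg (a := (-1 : ℝ)) (b := 0)
      (fun x : ℝ => ((|x| : ℝ) : ℂ) ^ s)
    simpa using this
  rw [← intervalIntegral.integral_add_adjacent_intervals (b := 0)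
    (hi.mono_set (by
      rw [Set.uIcc_of_le (by norm_num), Set.uIcc_of_le (by norm_num)]
      exact Set.Icc_subset_Icc_right (by norm_num)))
    (hi.mono_set (by
      rw [Set.uIcc_of_le (by norm_num), Set.uIcc_of_le (by norm_num)]
      exact Set.Icc_subset_Icc_left (by norm_num))), h, h']
  ring

/-- The weight `|x|^(α-1) (1-x²)^m`. -/
def weight (m : ℕ) (α : ℂ) (x : ℝ) : ℂ :=
  ((|x| : ℝ) : ℂ) ^ (α - 1) * (1 - (x : ℂ) ^ 2) ^ m

lemma intervalIntegrable_weight_mul {α : ℂ} (hα : 0 < α.re) (m : ℕ) {f : ℝ → ℂ}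
    (hf : Continuous f) :
    IntervalIntegrable (fun x => weight m α x * f x) volume (-1) 1 := by
  have h := (intervalIntegrable_abs_cpow (s := α - 1) (by simpa using hα)).mul_continuousOn
    (g := fun x : ℝ => (1 - (x : ℂ) ^ 2) ^ m * f x) (by fun_prop)
  simpa only [weight, mul_assoc] using h

lemma weight_mul_sq {α : ℂ} (hα : 0 < α.re) (m : ℕ) (x : ℝ) :
    weight m α x * (x : ℂ) ^ 2 = weight m (α + 2) x := by
  rcases eq_or_ne x 0 with rfl | hx
  · have h1 : α + 2 - 1 ≠ 0 := by
      intro h0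
      have := congrArg Complex.re h0
      simp at this
      linarith
    simp [weight, Complex.zero_cpow h1]
  · have hx' : ((|x| : ℝ) : ℂ) ≠ 0 := by simpa using hx
    have h1 : ((|x| : ℝ) : ℂ) ^ 2 = (x : ℂ) ^ 2 := by
      rw [← Complex.ofReal_pow, sq_abs, Complex.ofReal_pow]
    rw [weight, weight, show α + 2 - 1 = (α - 1) + 2 by ring, Complex.cpow_add _ _ hx',
      Complex.cpow_ofNat, h1]
    ring

lemma half_add_natCast_ne_zero {α : ℂ} (hα : 0 < α.re) (k : ℕ) : α / 2 + k ≠ 0 := by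
  intro h0
  have h1 := congrArg Complex.re h0
  have h2 : (α / 2).re = α.re / 2 := by simp
  rw [Complex.add_re, h2, Complex.natCast_re, Complex.zero_re] at h1
  have : (0 : ℝ) ≤ k := Nat.cast_nonneg k
  linarith

lemma prod_add_two_half_add (α : ℂ) (m : ℕ) :
    ∏ k ∈ Finset.range m, ((α + 2) / 2 + (k : ℂ)) =
      ∏ k ∈ Finset.range m, (α / 2 + ((k + 1 : ℕ) : ℂ)) := by
  refine Finset.prod_congr rfl fun k _ => ?_
  push_cast
  ring

/-- The beta value B(α/2, m+1). Splitting off one factor 1 - x² replaces m+1 by m at the parameters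
α and α+2, so the induction must let α vary. -/
lemma integral_weight {α : ℂ} (hα : 0 < α.re) (m : ℕ) :
    ∫ x in (-1 : ℝ)..1, weight m α x =
      m.factorial / ∏ k ∈ Finset.range (m + 1), (α / 2 + k) := by
  induction m generalizing α with
  | zero =>
    have h := integral_abs_cpow (s := α - 1) (by simpa using hα)
    simp only [weight, pow_zero, mul_one]
    rw [h]
    simp
  | succ m ih =>
    have hα2 : 0 < (α + 2).re := by simp; linarith
    have h1 : ∀ x : ℝ, weight (m + 1) α x = weight m α x - weight m (α + 2) x := by
      intro x
      rw [← weight_mul_sq hα]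
      simp only [weight]
      ring
    simp only [h1]
    rw [intervalIntegral.integral_sub
      (by simpa using intervalIntegrable_weight_mul hα m (f := fun _ => 1) continuous_const)
      (by simpa using intervalIntegrable_weight_mul hα2 m (f := fun _ => 1) continuous_const),
      ih hα, ih hα2]
    have h3 : ∏ k ∈ Finset.range m, (α / 2 + ((k + 1 : ℕ) : ℂ)) ≠ 0 :=
      Finset.prod_ne_zero_iff.2 fun k _ => half_add_natCast_ne_zero hα (k + 1)
    have h4 := half_add_natCast_ne_zero hα 0
    have h5 := half_add_natCast_ne_zero hα (m + 1)
    have h6 : α / 2 + ((m + 1 : ℕ) : ℂ) = α / 2 + ((0 : ℕ) : ℂ) + (m + 1) := by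
      push_cast
      ring
    rw [prod_add_two_half_add, Finset.prod_range_succ' _ (m + 1), Finset.prod_range_succ' _ m,
      Finset.prod_range_succ _ m, Nat.factorial_succ, Nat.cast_mul]
    -- Apart from common factors the claim is 1/u - 1/v = (m+1)/(uv) with v = u + m + 1.
    generalize ∏ k ∈ Finset.range m, (α / 2 + ((k + 1 : ℕ) : ℂ)) = Q at h3 ⊢
    generalize α / 2 + ((0 : ℕ) : ℂ) = u at h4 h6 ⊢
    generalize α / 2 + ((m + 1 : ℕ) : ℂ) = v at h5 h6 ⊢
    subst h6
    field_simp
    push_cast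
    ring

lemma integral_weight_mul_self {α : ℂ} (m : ℕ) :
    ∫ x in (-1 : ℝ)..1, weight m α x * x = 0 := by
  have h := intervalIntegral.integral_comp_neg (a := (-1 : ℝ)) (b := 1)
      (fun x : ℝ => weight m α x * x)
  have h1 : ∀ x : ℝ, weight m α (-x) * ((-x : ℝ) : ℂ) = -(weight m α x * x) := by
    intro x
    simp [weight]
  simp only [h1, intervalIntegral.integral_neg, neg_neg] at h
  linear_combination (-1 / 2 : ℂ) * h

lemma integral_weight_add_two {α : ℂ} (hα : 0 < α.re) (m : ℕ) :
    ∫ x in (-1 : ℝ)..1, weight m (α + 2) x =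
      α / (2 * (m + 1 : ℕ) + α) * ∫ x in (-1 : ℝ)..1, weight m α x := by
  have hα2 : 0 < (α + 2).re := by simp; linarith
  have h3 : ∏ k ∈ Finset.range m, (α / 2 + ((k + 1 : ℕ) : ℂ)) ≠ 0 :=
    Finset.prod_ne_zero_iff.2 fun k _ => half_add_natCast_ne_zero hα (k + 1)
  have h4 := half_add_natCast_ne_zero hα 0
  have h5 := half_add_natCast_ne_zero hα (m + 1)
  have h6 : 2 * ((m + 1 : ℕ) : ℂ) + α = 2 * (α / 2 + ((m + 1 : ℕ) : ℂ)) := by ring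
  have h7 : α = 2 * (α / 2 + ((0 : ℕ) : ℂ)) := by push_cast; ring
  rw [integral_weight hα, integral_weight hα2, prod_add_two_half_add,
    Finset.prod_range_succ' (fun k : ℕ => α / 2 + (k : ℂ)) m,
    Finset.prod_range_succ (fun k : ℕ => α / 2 + ((k + 1 : ℕ) : ℂ)) m, h6]
  generalize ∏ k ∈ Finset.range m, (α / 2 + ((k + 1 : ℕ) : ℂ)) = Q at h3 ⊢
  generalize α / 2 + ((0 : ℕ) : ℂ) = u at h4 h7 ⊢
  generalize α / 2 + ((m + 1 : ℕ) : ℂ) = v at h5 ⊢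
  subst h7
  field_simp

/-! ### Integrability and the recursion for the moments. -/

/-- In positive degree the region lies in [-1,1] × ball, the last coordinate first, and on this
product the singular factor depends on that coordinate alone. -/
lemma integrableOn_abs_lastCoeff_cpow (N : ℕ) {α : ℂ} (hα : 0 < α.re) :
    IntegrableOn (fun a : Fin N → ℝ => ((|lastCoeff a| : ℝ) : ℂ) ^ (α - 1)) (Omega N) := by
  rcases N with _ | n
  · simp only [lastCoeff_zero]
    exact continuous_const.continuousOn.integrableOn_compact (isCompact_Omega 0)
  obtain ⟨R, hR⟩ := (isCompact_Omega (n + 1)).isBounded.subset_closedBall 0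
  let e := MeasurableEquiv.piFinSuccAbove (fun _ : Fin (n + 1) => ℝ) (Fin.last n)
  have he : MeasurePreserving e :=
    volume_preserving_piFinSuccAbove (fun _ : Fin (n + 1) => ℝ) (Fin.last n)
  have h1 : IntegrableOn (fun x : ℝ => ((|x| : ℝ) : ℂ) ^ (α - 1)) (Set.Ioc (-1) 1) :=
    (intervalIntegrable_iff_integrableOn_Ioc_of_le (by norm_num)).1
      (intervalIntegrable_abs_cpow (by simpa using hα))
  have h1' := (integrableOn_Icc_iff_integrableOn_Ioc (by simp)).2 h1
  have h2 : IntegrableOn (fun _ : Fin n → ℝ => (1 : ℂ)) (Metric.closedBall 0 R) :=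
    continuous_const.continuousOn.integrableOn_compact (isCompact_closedBall _ _)
  have h3 : IntegrableOn
      (fun p : ℝ × (Fin n → ℝ) => ((|p.1| : ℝ) : ℂ) ^ (α - 1) * (1 : ℂ))
      (Set.Icc (-1) 1 ×ˢ Metric.closedBall 0 R) := by
    rw [IntegrableOn, Measure.volume_eq_prod, ← Measure.prod_restrict]
    exact Integrable.mul_prod h1' h2
  have h4 := (he.integrableOn_comp_preimage e.measurableEmbedding).2 h3
  refine (h4.mono_set ?_).congr_fun (fun a _ => ?_) (isClosed_Omega _).measurableSet
  · intro a ha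
    have ha1 := abs_lastCoeff_le ha
    rw [lastCoeff_eq] at ha1
    have ha2 := mem_closedBall_zero_iff.1 (hR ha)
    refine ⟨abs_le.1 ha1, mem_closedBall_zero_iff.2 ?_⟩
    rw [pi_norm_le_iff_of_nonneg ((norm_nonneg a).trans ha2)]
    exact fun i => (norm_le_pi_norm a _).trans ha2
  · simp [lastCoeff_eq, e, MeasurableEquiv.piFinSuccAbove]

lemma integrableOn_abs_lastCoeff_cpow_mul (N : ℕ) {α : ℂ} (hα : 0 < α.re)
    {f : (Fin N → ℝ) → ℂ} (hf : Continuous f) :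
    IntegrableOn (fun a : Fin N → ℝ => ((|lastCoeff a| : ℝ) : ℂ) ^ (α - 1) * f a) (Omega N) :=
  (integrableOn_abs_lastCoeff_cpow N hα).mul_continuousOn hf.continuousOn (isCompact_Omega N)

/-- The weighted moment `∫ |a_N|^(α-1) a_j dV` of the `j`-th coefficient. -/
def moment (N : ℕ) (α : ℂ) (j : ℕ) : ℂ :=
  ∫ a in Omega N, ((|lastCoeff a| : ℝ) : ℂ) ^ (α - 1) * (coeffAt a j : ℂ)

lemma continuous_ofReal_coeffAt {N : ℕ} (j : ℕ) :
    Continuous fun a : Fin N → ℝ => (coeffAt a j : ℂ) :=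
  Complex.continuous_ofReal.comp (continuous_coeffAt j)

lemma integrableOn_coeffAt (N j : ℕ) :
    IntegrableOn (fun a : Fin N → ℝ => (coeffAt a j : ℂ)) (Omega N) :=
  (continuous_ofReal_coeffAt j).continuousOn.integrableOn_compact
    (isCompact_Omega N)

lemma moment_one (N j : ℕ) : moment N 1 j = ∫ a in Omega N, (coeffAt a j : ℂ) := by
  simp [moment]

lemma C_eq_sum_moment (N : ℕ) {α : ℂ} (hα : 0 < α.re) (T : ℂ) :
    C N α T = ∑ j ∈ Finset.range (N + 1), moment N α j * T ^ (N - j) := by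
  simp only [C, integrand, moment, aeval_poly, Finset.mul_sum, ← mul_assoc]
  rw [integral_finsetSum]
  · exact Finset.sum_congr rfl fun j _ => integral_mul_const _ _
  · intro j _
    exact (integrableOn_abs_lastCoeff_cpow_mul N hα
      (continuous_ofReal_coeffAt j)).mul_const _

lemma moment_succ (n : ℕ) {α : ℂ} (hα : 0 < α.re) {j : ℕ} (hj : j ≤ n + 1) :
    moment (n + 1) α j =
      ∫ k in (-1 : ℝ)..1, ((|k| : ℝ) : ℂ) ^ (α - 1) * ((LinearMap.det (reflectMap n k) : ℝ) : ℂ) *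
        (moment n 1 j + k * moment n 1 (n + 1 - j)) := by
  rw [moment, setIntegral_Omega_succ _ (integrableOn_abs_lastCoeff_cpow_mul (n + 1) hα
    (continuous_ofReal_coeffAt j)),
    intervalIntegral.integral_of_le (by norm_num), integral_Ioc_eq_integral_Ioo]
  congr 1
  ext k
  simp only [lastCoeff_levinson, coeffAt_levinson _ _ hj]
  rw [integral_const_mul]
  push_cast
  rw [integral_add (integrableOn_coeffAt n j)
    ((integrableOn_coeffAt n (n + 1 - j)).const_mul _), integral_const_mul, moment_one, moment_one]
  ring

/-- The determinant is even in k, so the mirrored coefficient, which carries a factor k, integrates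
to zero. -/
lemma moment_odd (m : ℕ) {α : ℂ} (hα : 0 < α.re) {j : ℕ} (hj : j ≤ 2 * m + 1) :
    moment (2 * m + 1) α j =
      (∫ k in (-1 : ℝ)..1, weight m α k) * moment (2 * m) 1 j := by
  rw [moment_succ _ hα hj]
  have h : ∀ k : ℝ, ((|k| : ℝ) : ℂ) ^ (α - 1) * ((LinearMap.det (reflectMap (2 * m) k) : ℝ) : ℂ) *
        (moment (2 * m) 1 j + k * moment (2 * m) 1 (2 * m + 1 - j)) =
      weight m α k * moment (2 * m) 1 j +
        weight m α k * k * moment (2 * m) 1 (2 * m + 1 - j) := by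
    intro k
    rw [det_reflectMap_even, weight]
    push_cast
    ring
  simp only [h]
  rw [intervalIntegral.integral_add, intervalIntegral.integral_mul_const,
    intervalIntegral.integral_mul_const, integral_weight_mul_self, zero_mul, add_zero]
  · exact intervalIntegrable_weight_mul hα m continuous_const
  · exact (intervalIntegrable_weight_mul hα m Complex.continuous_ofReal).mul_const _

/-- Here (1+k)(A+kB) = (A + k²B) + k(A+B): the odd part drops out, and k² shifts α to α+2. -/
lemma moment_even (m : ℕ) {α : ℂ} (hα : 0 < α.re) {j : ℕ} (hj : j ≤ 2 * m + 2) :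
    moment (2 * m + 2) α j =
      (∫ k in (-1 : ℝ)..1, weight m α k) * moment (2 * m + 1) 1 j +
        (∫ k in (-1 : ℝ)..1, weight m (α + 2) k) * moment (2 * m + 1) 1 (2 * m + 2 - j) := by
  rw [moment_succ _ hα hj]
  have h : ∀ k : ℝ, ((|k| : ℝ) : ℂ) ^ (α - 1) *
      ((LinearMap.det (reflectMap (2 * m + 1) k) : ℝ) : ℂ) *
        (moment (2 * m + 1) 1 j + k * moment (2 * m + 1) 1 (2 * m + 1 + 1 - j)) =
      (weight m α k * moment (2 * m + 1) 1 j +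
        weight m (α + 2) k * moment (2 * m + 1) 1 (2 * m + 2 - j)) +
        weight m α k * k * (moment (2 * m + 1) 1 j + moment (2 * m + 1) 1 (2 * m + 2 - j)) := by
    intro k
    rw [det_reflectMap_odd, ← weight_mul_sq hα, weight]
    push_cast
    ring
  have hα2 : 0 < (α + 2).re := by simp; linarith
  have h1 := intervalIntegrable_weight_mul hα m
    (continuous_const (y := moment (2 * m + 1) 1 j))
  have h2 := intervalIntegrable_weight_mul hα2 m
    (continuous_const (y := moment (2 * m + 1) 1 (2 * m + 2 - j)))
  simp only [h]
  rw [intervalIntegral.integral_add (h1.add h2)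
    ((intervalIntegrable_weight_mul hα m Complex.continuous_ofReal).mul_const _),
    intervalIntegral.integral_add h1 h2, intervalIntegral.integral_mul_const,
    intervalIntegral.integral_mul_const, intervalIntegral.integral_mul_const,
    integral_weight_mul_self, zero_mul, add_zero]

/-! ### Closed forms of the moments. -/

/-- The product `∏_{k<m} (1+2k)/(α+2k)`. -/
def ratioProd (m : ℕ) (α : ℂ) : ℂ :=
  ∏ k ∈ Finset.range m, (1 + 2 * (k : ℂ)) / (α + 2 * (k : ℂ))

lemma add_two_mul_natCast_ne_zero {α : ℂ} (hα : 0 < α.re) (k : ℕ) : α + 2 * (k : ℂ) ≠ 0 := by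
  have h := half_add_natCast_ne_zero hα k
  intro h0
  apply h
  linear_combination h0 / 2

lemma ratioProd_one (m : ℕ) : ratioProd m 1 = 1 :=
  Finset.prod_eq_one fun k _ => div_self (add_two_mul_natCast_ne_zero (by simp) k)

lemma prod_odd_mul (m : ℕ) :
    (∏ k ∈ Finset.range (m + 1), (1 + 2 * (k : ℂ))) * (2 ^ m * m.factorial) =
      (2 * m + 1).factorial := by
  induction m with
  | zero => simp
  | succ m ih =>
    rw [Finset.prod_range_succ, show 2 * (m + 1) + 1 = (2 * m + 1) + 1 + 1 by ring,
      Nat.factorial_succ (2 * m + 1 + 1), Nat.factorial_succ (2 * m + 1), Nat.factorial_succ m]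
    push_cast
    rw [← ih]
    ring

/-- Normalized at α = 1, where `ratioProd` is 1: the factors accumulate to `D`, and only the last
recursion step contributes a dependence on α. -/
lemma integral_weight_eq_factor {α : ℂ} (hα : 0 < α.re) (m : ℕ) :
    ∫ x in (-1 : ℝ)..1, weight m α x = (factor m : ℂ) * ratioProd (m + 1) α := by
  have h1 : ∏ k ∈ Finset.range (m + 1), (α + 2 * (k : ℂ)) =
      2 ^ (m + 1) * ∏ k ∈ Finset.range (m + 1), (α / 2 + k) := by
    rw [Finset.prod_congr rfl fun (k : ℕ) _ => show α + 2 * (k : ℂ) = 2 * (α / 2 + k) by ring,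
      Finset.prod_mul_distrib, Finset.prod_const, Finset.card_range]
  have h2 : ∏ k ∈ Finset.range (m + 1), (α / 2 + (k : ℂ)) ≠ 0 :=
    Finset.prod_ne_zero_iff.2 fun k _ => half_add_natCast_ne_zero hα k
  have h3 : ((2 * m + 1).factorial : ℂ) ≠ 0 := by exact_mod_cast Nat.factorial_ne_zero _
  rw [integral_weight hα, factor, ratioProd, Finset.prod_div_distrib, h1]
  push_cast
  field_simp
  rw [← prod_odd_mul]
  ring

lemma D_odd (m : ℕ) : D (2 * m + 1) = factor m * D (2 * m) := by
  have h1 : ¬ Even (2 * m + 1) := by simp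
  rw [D, D, if_neg h1, if_pos (even_two_mul m), show (2 * m + 1) / 2 = m by omega,
    show 2 * m / 2 = m by omega]

lemma D_even (m : ℕ) : D (2 * (m + 1)) = factor m * D (2 * m + 1) := by
  rw [D_odd, D, D, if_pos (even_two_mul _), if_pos (even_two_mul m),
    show 2 * (m + 1) / 2 = m + 1 by omega, show 2 * m / 2 = m by omega, Finset.prod_range_succ]
  ring

lemma moment_of_lt {N j : ℕ} (α : ℂ) (h : N < j) : moment N α j = 0 := by
  simp [moment, coeffAt_of_lt _ h]

/-- The formulas for the even-indexed moments in even degree `2m`. -/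
def EvenDegreeMoments (m : ℕ) : Prop :=
  ∀ α : ℂ, 0 < α.re → ∀ l ≤ m, moment (2 * m) α (2 * l) =
    (D (2 * m) : ℂ) * ratioProd m α * ((2 * ((m - l : ℕ) : ℂ) + α) / (2 * m + α) *
      ((m.factorial : ℂ) ^ 2 / ((2 * m).factorial : ℂ)) * (l.centralBinom : ℂ) *
      ((m - l).centralBinom : ℂ))

/-- The formulas for the even-indexed moments in odd degree `2m + 1`. -/
def OddDegreeMoments (m : ℕ) : Prop :=
  ∀ α : ℂ, 0 < α.re → ∀ l ≤ m + 1, moment (2 * m + 1) α (2 * l) =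
    (D (2 * m + 1) : ℂ) * ratioProd (m + 1) α * (((m + 1 - l : ℕ) : ℂ) / 2 / (2 * m + 1) *
      ((m.factorial : ℂ) ^ 2 / ((2 * m).factorial : ℂ)) * (l.centralBinom : ℂ) *
      ((m + 1 - l).centralBinom : ℂ))

/-- The closed form includes l = m+1, beyond the degree, where its factor m+1-l vanishes; the next
even step meets this index as the mirror of l = 0. -/
lemma oddDegreeMoments_of_even {m : ℕ} (h : EvenDegreeMoments m) : OddDegreeMoments m := by
  intro α hα l hl
  rcases Nat.lt_or_ge m l with hml | hml
  · obtain rfl : l = m + 1 := by omega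
    rw [moment_of_lt _ (by omega)]
    simp
  · rw [moment_odd m hα (by omega), h 1 (by simp) l hml, integral_weight_eq_factor hα, D_odd,
      ratioProd_one]
    obtain ⟨i, rfl⟩ := Nat.exists_eq_add_of_le hml
    have hc : ((i : ℂ) + 1) * ((i + 1).centralBinom : ℂ) = 2 * (2 * i + 1) * i.centralBinom := by
      exact_mod_cast Nat.succ_mul_centralBinom_succ i
    rw [show l + i - l = i by omega, show l + i + 1 - l = i + 1 by omega]
    push_cast
    linear_combination (-(factor (l + i) : ℂ) * D (2 * (l + i)) * ratioProd (l + i + 1) α *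
      (1 / 2 / (2 * (l + i) + 1)) *
      (((l + i).factorial : ℂ) ^ 2 / ((2 * (l + i)).factorial : ℂ)) * (l.centralBinom : ℂ)) * hc

/-- With i = m+1-l, reflection keeps the product of central binomials and exchanges the factors i
and l. The claim becomes i + lα/(2(m+1)+α) = (m+1)(2i+α)/(2(m+1)+α), which holds since i + l = m+1.
-/
lemma evenDegreeMoments_of_odd {m : ℕ} (h : OddDegreeMoments m) : EvenDegreeMoments (m + 1) := by
  intro α hα l hl
  have h1 := moment_even m hα (j := 2 * l) (by omega)
  rw [show 2 * m + 2 - 2 * l = 2 * (m + 1 - l) by omega, h 1 (by simp) l hl,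
    h 1 (by simp) (m + 1 - l) (by omega), integral_weight_add_two hα, integral_weight_eq_factor hα,
    ratioProd_one, show m + 1 - (m + 1 - l) = l by omega] at h1
  rw [show 2 * (m + 1) = 2 * m + 2 by ring, h1, show 2 * m + 2 = 2 * (m + 1) by ring, D_even]
  have h2 : 2 * ((m + 1 : ℕ) : ℂ) + α ≠ 0 := by
    rw [add_comm]
    exact add_two_mul_natCast_ne_zero hα (m + 1)
  have h3 : (2 * (m : ℂ) + 1) ≠ 0 := by exact_mod_cast Nat.succ_ne_zero (2 * m)
  have h4 : ((2 * m).factorial : ℂ) ≠ 0 := by exact_mod_cast Nat.factorial_ne_zero _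
  have h5 : ((m : ℂ) + 1) ≠ 0 := by exact_mod_cast Nat.succ_ne_zero m
  have h6 : ((2 * (m + 1)).factorial : ℂ) = 2 * (m + 1) * (2 * m + 1) * (2 * m).factorial := by
    rw [show 2 * (m + 1) = 2 * m + 1 + 1 by ring, Nat.factorial_succ, Nat.factorial_succ]
    push_cast
    ring
  have h7 : ((m + 1 : ℕ) : ℂ) = (l : ℂ) + ((m + 1 - l : ℕ) : ℂ) := by
    rw [← Nat.cast_add]
    congr 1
    omega
  have h8 : (m : ℂ) = (l : ℂ) + ((m + 1 - l : ℕ) : ℂ) - 1 := by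
    rw [← h7]
    push_cast
    ring
  rw [h6, Nat.factorial_succ]
  generalize ((m + 1 - l : ℕ) : ℂ) = i at *
  push_cast at h2 ⊢
  field_simp
  rw [h8]
  ring

lemma moment_zero_zero (α : ℂ) : moment 0 α 0 = 1 := by
  have h : Omega 0 = Set.univ := by
    ext a
    simp [Omega, poly, coeffs]
  have hv : volume.real (Set.univ : Set (Fin 0 → ℝ)) = 1 := by
    rw [measureReal_def, volume_pi, Measure.pi_of_empty _ 0]
    simp
  simp [moment, lastCoeff_zero, coeffAt_zero, h, hv]

lemma evenDegreeMoments (m : ℕ) : EvenDegreeMoments m := by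
  induction m with
  | zero =>
    intro α hα l hl
    obtain rfl : l = 0 := by omega
    have hα0 : α ≠ 0 := by
      rintro rfl
      simp at hα
    simp [moment_zero_zero, D, ratioProd, hα0]
  | succ m ih => exact evenDegreeMoments_of_odd (oddDegreeMoments_of_even ih)

lemma oddDegreeMoments (m : ℕ) : OddDegreeMoments m :=
  oddDegreeMoments_of_even (evenDegreeMoments m)

/-- Moments of the coefficients of odd index vanish. -/
lemma moment_odd_index (N : ℕ) {α : ℂ} (hα : 0 < α.re) {j : ℕ} (hj : Odd j) :
    moment N α j = 0 := by
  induction N generalizing α j with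
  | zero => exact moment_of_lt _ hj.pos
  | succ n ih =>
    rcases Nat.lt_or_ge (n + 1) j with h | h
    · exact moment_of_lt _ h
    rcases Nat.even_or_odd' n with ⟨m, rfl | rfl⟩
    · rw [moment_odd m hα h, ih (by simp) hj, mul_zero]
    · rw [moment_even m hα h, ih (by simp) hj, ih (by simp) (Nat.Even.sub_odd h ⟨m + 1, by ring⟩ hj)]
      simp

/-! ### Assembly of C_N, the moments of |a_N| and the volume. -/

lemma sum_range_of_odd_eq_zero {f : ℕ → ℂ} (hf : ∀ j, Odd j → f j = 0) (m : ℕ) :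
    ∑ j ∈ Finset.range (2 * m + 1), f j = ∑ i ∈ Finset.range (m + 1), f (2 * i) := by
  induction m with
  | zero => simp
  | succ m ih =>
    rw [show 2 * (m + 1) + 1 = 2 * m + 1 + 1 + 1 by ring, Finset.sum_range_succ,
      Finset.sum_range_succ, ih, Finset.sum_range_succ _ (m + 1), hf (2 * m + 1) (by simp),
      add_zero]
    rfl

lemma C_even_eq (m : ℕ) {α : ℂ} (hα : 0 < α.re) (T : ℂ) :
    C (2 * m) α T = (D (2 * m) : ℂ) * ratioProd m α *
      ∑ i ∈ Finset.range (m + 1), (2 * (i : ℂ) + α) / (2 * (m : ℂ) + α) *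
        ((m.factorial : ℂ) ^ 2 / ((2 * m).factorial : ℂ)) *
        ((2 * i).choose i : ℂ) * ((2 * m - 2 * i).choose (m - i) : ℂ) * T ^ (2 * i) := by
  rw [C_eq_sum_moment _ hα, sum_range_of_odd_eq_zero
    -- The moment of index j goes with T^(N-j), so the sum is reversed: l = m - i.
    (fun j hj => by rw [moment_odd_index _ hα hj, zero_mul]), ← Finset.sum_range_reflect,
    Finset.mul_sum]
  refine Finset.sum_congr rfl fun i hi => ?_
  have hi' : i ≤ m := by simpa [Nat.lt_succ_iff] using hi
  rw [show m + 1 - 1 - i = m - i by omega, evenDegreeMoments m α hα _ (Nat.sub_le _ _),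
    show m - (m - i) = i by omega, show 2 * m - 2 * (m - i) = 2 * i by omega,
    ← Nat.mul_sub, ← Nat.centralBinom_eq_two_mul_choose, ← Nat.centralBinom_eq_two_mul_choose]
  ring

lemma C_odd_eq (m : ℕ) {α : ℂ} (hα : 0 < α.re) (T : ℂ) :
    C (2 * m + 1) α T = (D (2 * m + 1) : ℂ) * ratioProd (m + 1) α *
      ∑ i ∈ Finset.range (m + 1), (2 * (i : ℂ) + 1) / (2 * (m : ℂ) + 1) *
        ((m.factorial : ℂ) ^ 2 / ((2 * m).factorial : ℂ)) *
        ((2 * i).choose i : ℂ) * ((2 * m - 2 * i).choose (m - i) : ℂ) * T ^ (2 * i + 1) := by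
  rw [C_eq_sum_moment _ hα, Finset.sum_range_succ, moment_odd_index _ hα (by simp), zero_mul,
    add_zero, sum_range_of_odd_eq_zero
    (fun j hj => by rw [moment_odd_index _ hα hj, zero_mul]), ← Finset.sum_range_reflect,
    Finset.mul_sum]
  refine Finset.sum_congr rfl fun i hi => ?_
  have hi' : i ≤ m := by simpa [Nat.lt_succ_iff] using hi
  -- Turns the factor (i+1)/2 with central binomial at i+1 into 2i+1 with central binomial at i.
  have hc : ((i : ℂ) + 1) * ((i + 1).centralBinom : ℂ) = 2 * (2 * i + 1) * i.centralBinom := by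
    exact_mod_cast Nat.succ_mul_centralBinom_succ i
  rw [show m + 1 - 1 - i = m - i by omega, oddDegreeMoments m α hα _ (by omega),
    show m + 1 - (m - i) = i + 1 by omega, show 2 * m + 1 - 2 * (m - i) = 2 * i + 1 by omega,
    ← Nat.mul_sub, ← Nat.centralBinom_eq_two_mul_choose, ← Nat.centralBinom_eq_two_mul_choose]
  push_cast
  linear_combination ((D (2 * m + 1) : ℂ) * ratioProd (m + 1) α * (1 / 2 / (2 * m + 1)) *
      ((m.factorial : ℂ) ^ 2 / ((2 * m).factorial : ℂ)) * ((m - i).centralBinom : ℂ) *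
      T ^ (2 * i + 1)) * hc

lemma factorial_sq_div_mul_centralBinom (m : ℕ) :
    (m.factorial : ℂ) ^ 2 / ((2 * m).factorial : ℂ) * (m.centralBinom : ℂ) = 1 := by
  have h : ((m.centralBinom : ℂ) * m.factorial * m.factorial) = (2 * m).factorial := by
    have := Nat.choose_mul_factorial_mul_factorial (show m ≤ 2 * m by omega)
    rw [show 2 * m - m = m by omega, ← Nat.centralBinom_eq_two_mul_choose] at this
    exact_mod_cast this
  have h4 : ((2 * m).factorial : ℂ) ≠ 0 := by exact_mod_cast Nat.factorial_ne_zero _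
  field_simp
  linear_combination h

lemma moment_zero_index (N : ℕ) {α : ℂ} (hα : 0 < α.re) :
    moment N α 0 = (D N : ℂ) * ratioProd ((N + 1) / 2) α := by
  rcases Nat.even_or_odd' N with ⟨m, rfl | rfl⟩
  · have h := evenDegreeMoments m α hα 0 (Nat.zero_le _)
    have h2 : 2 * (m : ℂ) + α ≠ 0 := by
      rw [add_comm]
      exact add_two_mul_natCast_ne_zero hα m
    have h3 := factorial_sq_div_mul_centralBinom m
    rw [mul_zero, Nat.sub_zero, div_self h2, Nat.centralBinom_zero, Nat.cast_one, one_mul, mul_one,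
      h3, mul_one] at h
    rw [h, show (2 * m + 1) / 2 = m by omega]
  · have h := oddDegreeMoments m α hα 0 (Nat.zero_le _)
    have h2 : (2 * (m : ℂ) + 1) ≠ 0 := by exact_mod_cast Nat.succ_ne_zero (2 * m)
    have h3 := factorial_sq_div_mul_centralBinom m
    have hc : ((m : ℂ) + 1) * ((m + 1).centralBinom : ℂ) = 2 * (2 * m + 1) * m.centralBinom := by
      exact_mod_cast Nat.succ_mul_centralBinom_succ m
    rw [mul_zero, Nat.sub_zero, Nat.centralBinom_zero, Nat.cast_one, mul_one] at h
    rw [h, show (2 * m + 1 + 1) / 2 = m + 1 by omega]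
    have h4 : (((m + 1 : ℕ) : ℂ) / 2 / (2 * m + 1) *
        ((m.factorial : ℂ) ^ 2 / ((2 * m).factorial : ℂ)) * ((m + 1).centralBinom : ℂ)) = 1 := by
      refine Eq.trans ?_ h3
      push_cast
      generalize (m.factorial : ℂ) ^ 2 / ((2 * m).factorial : ℂ) = q
      linear_combination q / 2 / (2 * m + 1) * hc + q * m.centralBinom * mul_inv_cancel₀ h2
    rw [h4, mul_one]

lemma ratioProd_eq_ascPochhammer {α : ℂ} (hα : 0 < α.re) (r : ℕ) :
    ratioProd r α = (ascPochhammer ℂ r).eval (1 / 2) / (ascPochhammer ℂ r).eval (α / 2) := by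
  induction r with
  | zero => simp [ratioProd]
  | succ r ih =>
    have h1 := add_two_mul_natCast_ne_zero hα r
    have h2 := half_add_natCast_ne_zero hα r
    rw [ascPochhammer_succ_eval, ascPochhammer_succ_eval, mul_div_mul_comm, ← ih, ratioProd,
      Finset.prod_range_succ, ← ratioProd]
    congr 1
    field_simp

lemma moment_zero_eq (N : ℕ) (α : ℂ) :
    moment N α 0 = ∫ a in Omega N, ((|lastCoeff a| : ℝ) : ℂ) ^ (α - 1) := by
  simp [moment, coeffAt_zero]

lemma volume_Omega (N : ℕ) : volume (Omega N) = ENNReal.ofReal (D N) := by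
  have h := moment_zero_index N (α := 1) (by simp)
  rw [moment_one, ratioProd_one, mul_one] at h
  simp only [coeffAt_zero, Complex.ofReal_one, integral_const, measureReal_restrict_apply_univ,
    Complex.real_smul, mul_one] at h
  rw [← Complex.ofReal_injective h, ofReal_measureReal (isCompact_Omega N).measure_ne_top]

end

end UnitDiscPoly

theorem mainTheorem3 :
    -- `N = 2m + 1`
    (∀ (m : ℕ) (α T : ℂ), 0 < α.re →
      IntegrableOn (UnitDiscPoly.integrand (2 * m + 1) α T)
        (UnitDiscPoly.Omega (2 * m + 1)) volume ∧
      UnitDiscPoly.C (2 * m + 1) α T =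
        (UnitDiscPoly.D (2 * m + 1) : ℂ) *
          (∏ k ∈ Finset.range (m + 1), (1 + 2 * (k : ℂ)) / (α + 2 * (k : ℂ))) *
          ∑ i ∈ Finset.range (m + 1),
            (2 * (i : ℂ) + 1) / (2 * (m : ℂ) + 1) *
              ((m.factorial : ℂ) ^ 2 / ((2 * m).factorial : ℂ)) *
              ((2 * i).choose i : ℂ) * ((2 * m - 2 * i).choose (m - i) : ℂ) *
              T ^ (2 * i + 1)) ∧
    -- `N = 2m`
    (∀ (m : ℕ) (α T : ℂ), 0 < α.re →
      IntegrableOn (UnitDiscPoly.integrand (2 * m) α T)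
        (UnitDiscPoly.Omega (2 * m)) volume ∧
      UnitDiscPoly.C (2 * m) α T =
        (UnitDiscPoly.D (2 * m) : ℂ) *
          (∏ k ∈ Finset.range m, (1 + 2 * (k : ℂ)) / (α + 2 * (k : ℂ))) *
          ∑ i ∈ Finset.range (m + 1),
            (2 * (i : ℂ) + α) / (2 * (m : ℂ) + α) *
              ((m.factorial : ℂ) ^ 2 / ((2 * m).factorial : ℂ)) *
              ((2 * i).choose i : ℂ) * ((2 * m - 2 * i).choose (m - i) : ℂ) *
              T ^ (2 * i)) ∧
    -- the moments of `|a_N|`; `(N + 1) / 2` (rounded down) is `⌊(N - 1) / 2⌋ + 1`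
    (∀ (N : ℕ) (α : ℂ), 0 < α.re →
      IntegrableOn
        (fun a : Fin N → ℝ => ((|UnitDiscPoly.lastCoeff a| : ℝ) : ℂ) ^ (α - 1))
        (UnitDiscPoly.Omega N) volume ∧
      (∫ a in UnitDiscPoly.Omega N, ((|UnitDiscPoly.lastCoeff a| : ℝ) : ℂ) ^ (α - 1)) =
        (UnitDiscPoly.D N : ℂ) *
          ∏ k ∈ Finset.range ((N + 1) / 2), (1 + 2 * (k : ℂ)) / (α + 2 * (k : ℂ)) ∧
      (∫ a in UnitDiscPoly.Omega N, ((|UnitDiscPoly.lastCoeff a| : ℝ) : ℂ) ^ (α - 1)) =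
        (UnitDiscPoly.D N : ℂ) *
          ((ascPochhammer ℂ ((N + 1) / 2)).eval (1 / 2) /
            (ascPochhammer ℂ ((N + 1) / 2)).eval (α / 2))) ∧
    -- the volume
    (∀ N : ℕ, volume (UnitDiscPoly.Omega N) = ENNReal.ofReal (UnitDiscPoly.D N)) := by
  refine ⟨fun m α T hα => ⟨?_, UnitDiscPoly.C_odd_eq m hα T⟩,
    fun m α T hα => ⟨?_, UnitDiscPoly.C_even_eq m hα T⟩, fun N α hα => ⟨?_, ?_, ?_⟩,
    UnitDiscPoly.volume_Omega⟩
  · exact UnitDiscPoly.integrableOn_abs_lastCoeff_cpow_mul _ hα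
      (UnitDiscPoly.continuous_aeval_poly T)
  · exact UnitDiscPoly.integrableOn_abs_lastCoeff_cpow_mul _ hα
      (UnitDiscPoly.continuous_aeval_poly T)
  · exact UnitDiscPoly.integrableOn_abs_lastCoeff_cpow N hα
  · rw [← UnitDiscPoly.moment_zero_eq]
    exact UnitDiscPoly.moment_zero_index N hα
  · rw [← UnitDiscPoly.moment_zero_eq, UnitDiscPoly.moment_zero_index N hα,
      UnitDiscPoly.ratioProd_eq_ascPochhammer hα]
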